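/- Write $[N]=\{1,\dots,N\}$, and let $Q_N$ be the Boolean lattice of all subsets of $[N]$ ordered by inclusion; its layer $j$, written $\binom{[N]}{j}$, consists of the subsets of size $j$. A poset $P$ is a weak subposet of a poset $P'$ if there is an injective map $f:P\to P'$ such that $x\le y$ implies $f(x)\le f(y)$. Subfamilies of $Q_N$ are ordered by inclusion. Let $m,n$ be natural numbers with $m\ge 2$ and $n\ge\sqrt{32m+260}+18$. Then there is a partition $Q_{n+m}=\mathcal B\sqcup\mathcal R$ into a blue family $\mathcal B$ and a red family $\mathcal R$ such that $Q_m$ is not a weak subposet of $\mathcal B$ and $Q_n$ is not a weak subposet of $\mathcal R$. Moreover, $\mathcal B$ can be taken of the following form: there are an integer $k$ with $\sqrt{8(n+m)-15}\le k\le n-1-\sqrt{8(n+m)-15}$, a prime $p$ with $n+m\le p<2(n+m-1)$ and an integer $d\in[p]$ such that $$\mathcal B=\binom{[n+m]}{k}\cup\mathcal C\cup\bigcup_{j=k+3}^{k+m+1}\binom{[n+m]}{j},\qquad \mathcal C=\Bigl\{S\in\binom{[n+m]}{k+1}:\sum_{s\in S}s\equiv d\pmod p\Bigr\},$$ and any two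 distinct members of $\mathcal C$ have symmetric difference of size at least $4$. -/

import Mathlib

/-- The Boolean lattice of dimension `N`: all subsets of an `N`-element set, ordered by inclusion.
The ground set `{1, …, N}` is represented by `Fin N`, where `i : Fin N` stands for the integer
`i + 1`. -/
abbrev BooleanLattice (N : ℕ) : Type := Finset (Fin N)

/-- `P` is a weak subposet of `Q`: there is an injective order-preserving map from `P` to `Q`. -/
def IsWeakSubposet (P Q : Type*) [PartialOrder P] [PartialOrder Q] : Prop :=
  ∃ f : P → Q, Function.Injective f ∧ Monotone f

/-- The `k`-th layer of the Boolean lattice: all subsets of size `k`. -/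
def layer (N k : ℕ) : Set (BooleanLattice N) :=
  {S | S.card = k}

/-- The constant-weight code of all `w`-element subsets of `{1, …, N}` whose sum of elements is
congruent to `d` modulo `p`. -/
def sumCode (N w p d : ℕ) : Set (BooleanLattice N) :=
  {S | S.card = w ∧ (∑ i ∈ S, ((i : ℕ) + 1)) ≡ d [MOD p]}

/-! ### Sums of distinct residues modulo a prime, by the polynomial method. -/

section RestrictedSums

open Finset MvPolynomial
open scoped Nat

/-! Blue uses only `m + 1` set sizes, so a copy of `Q_m` sends its bottom to layer `k` and its atoms
to the code. But two codewords at distance at least 4 share at most `k - 1` elements, so no `k`-set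
lies below both.

For red, a copy `f` of `Q_n` satisfies `#S ≤ #(f S) ≤ #S + m`. Avoiding the full blue layers forces
rank `k` to `k + 1`, rank `k + 1` to `k + 2`, and atoms to atoms. Hence `f S` is the image of `S`
under an injection `g` of ground sets plus one extra element, and `exists_eq_of_star_eq_or_eq` shows
that this element is a fixed `v` whenever `v` is not in that image. Since `k * (n - 1 - k) > p - 1`,
the `k`-subsets of the image of `g` without `v` have sums in every residue class
(`exists_subset_card_eq_sum_eq`), so some `f S` is a codeword, which is blue. -/

theorem det_vandermonde_X_eq_sum {R : Type*} [CommRing R] (k : ℕ) :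
    (Matrix.vandermonde (X : Fin k → MvPolynomial (Fin k) R)).det =
      ∑ σ : Equiv.Perm (Fin k), monomial (Finsupp.equivFunOnFinite.symm fun i ↦ (σ i : ℕ))
        ((Equiv.Perm.sign σ : ℤ) : R) := by
  rw [← Matrix.det_transpose, Matrix.det_apply']
  refine Finset.sum_congr rfl fun σ _ ↦ ?_
  simp only [Matrix.transpose_apply, Matrix.vandermonde_apply, prod_X_pow]
  have h : ((Equiv.Perm.sign σ : ℤ) : MvPolynomial (Fin k) R) = C ((Equiv.Perm.sign σ : ℤ) : R) := by
    simp
  rw [h, C_mul_monomial, mul_one]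
  exact congrArg (fun e ↦ monomial e _) (Finsupp.ext fun i ↦ by simp)

theorem totalDegree_det_vandermonde_X_le {R : Type*} [CommRing R] (k : ℕ) :
    (Matrix.vandermonde (X : Fin k → MvPolynomial (Fin k) R)).det.totalDegree ≤
      ∑ i : Fin k, (i : ℕ) := by
  rw [det_vandermonde_X_eq_sum]
  refine totalDegree_finsetSum_le fun σ _ ↦ (totalDegree_monomial_le _ _).trans ?_
  rw [Finsupp.sum_fintype _ _ (by simp)]
  simp only [Finsupp.equivFunOnFinite_symm_apply_apply]
  exact (Equiv.sum_comp σ fun i : Fin k ↦ (i : ℕ)).le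

/-- Replacing the powers `x ^ j` by monic polynomials of degree `j`, here falling factorials, leaves
the determinant unchanged. -/
theorem det_vandermonde_natCast_eq_sum_descFactorial {R : Type*} [CommRing R] [IsDomain R] {k : ℕ}
    (c : Fin k → ℕ) :
    (Matrix.vandermonde fun i ↦ (c i : R)).det =
      ∑ σ : Equiv.Perm (Fin k), ((Equiv.Perm.sign σ : ℤ) : R) *
        ((∏ i, (c i).descFactorial (σ i) : ℕ) : R) := by
  rw [Matrix.det_eval_matrixOfPolynomials_eq_det_vandermonde _
    (fun i : Fin k ↦ descPochhammer R i) (fun i ↦ descPochhammer_natDegree R i)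
    (fun i ↦ monic_descPochhammer R i), ← Matrix.det_transpose, Matrix.det_apply']
  simp [Matrix.transpose_apply, descPochhammer_eval_eq_descFactorial]

/-- Each permutation contributes a multinomial coefficient `M! / ∏ (c i - σ i)!`; multiplied by `∏
(c i)!` it becomes `M!` times falling factorials, which sum to the Vandermonde determinant. Terms
with some `σ i > c i` vanish on both sides. -/
theorem prod_factorial_mul_coeff_sum_X_pow_mul_vandermonde {R : Type*} [CommRing R] [IsDomain R]
    {k M : ℕ} (c : Fin k → ℕ) (hc : ∑ i, c i = M + ∑ i : Fin k, (i : ℕ)) :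
    ((∏ i, (c i)! : ℕ) : R) * coeff (Finsupp.equivFunOnFinite.symm c)
        ((∑ i, X i) ^ M * (Matrix.vandermonde (X : Fin k → MvPolynomial (Fin k) R)).det) =
      (M ! : R) * (Matrix.vandermonde fun i ↦ (c i : R)).det := by
  rw [det_vandermonde_X_eq_sum, det_vandermonde_natCast_eq_sum_descFactorial, Finset.mul_sum,
    coeff_sum, Finset.mul_sum, Finset.mul_sum]
  refine Finset.sum_congr rfl fun σ _ ↦ ?_
  rw [coeff_mul_monomial', coeff_sum_X_pow_of_fintype]
  by_cases hle : ∀ i, (σ i : ℕ) ≤ c i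
  · have hle' : (Finsupp.equivFunOnFinite.symm fun i ↦ (σ i : ℕ)) ≤
        Finsupp.equivFunOnFinite.symm c := fun i ↦ hle i
    have hsum : ∑ i, (c i - (σ i : ℕ)) = M := by
      rw [Finset.sum_tsub_distrib _ fun i _ ↦ hle i, hc,
        Equiv.sum_comp σ fun i : Fin k ↦ (i : ℕ), Nat.add_sub_cancel]
    rw [if_pos hle', if_pos (by rw [Finsupp.sum_fintype _ _ (by simp)]; exact hsum)]
    have hm := Nat.multinomial_spec univ fun i ↦ c i - (σ i : ℕ)
    rw [hsum] at hm
    rw [Finsupp.multinomial_eq_of_support_subset (Finset.subset_univ _)]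
    have hp : ∏ i, (c i)! = (∏ i, (c i - (σ i : ℕ))!) * ∏ i, (c i).descFactorial (σ i) := by
      rw [← Finset.prod_mul_distrib]
      exact Finset.prod_congr rfl fun i _ ↦ (Nat.factorial_mul_descFactorial (hle i)).symm
    rw [← hm, hp]
    change _ * (((Nat.multinomial univ fun i ↦ c i - (σ i : ℕ) : ℕ) : R) * _) = _
    push_cast
    ring
  · have hle' : ¬ (Finsupp.equivFunOnFinite.symm fun i ↦ (σ i : ℕ)) ≤
        Finsupp.equivFunOnFinite.symm c := fun h ↦ hle fun i ↦ h i
    push Not at hle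
    obtain ⟨i, hi⟩ := hle
    have h0 : ∏ i, (c i).descFactorial (σ i) = 0 :=
      Finset.prod_eq_zero (Finset.mem_univ i) (Nat.descFactorial_eq_zero_iff_lt.2 hi)
    rw [if_neg hle', h0]
    simp

theorem exists_strictMono_sum_eq {k n M : ℕ} (h : M < k * (n - k)) :
    ∃ c : Fin k → ℕ, StrictMono c ∧ (∀ i, c i < n) ∧ ∑ i, c i = M + ∑ i : Fin k, (i : ℕ) := by
  have hk : 0 < k := Nat.pos_of_mul_pos_right (Nat.zero_lt_of_lt h)
  have hq : M / k < n - k := Nat.div_lt_of_lt_mul h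
  -- Spread `M` evenly over the staircase `0, …, k - 1`, the last `M % k` entries taking one unit
  -- more.
  refine ⟨fun i ↦ i + (M / k + if (i : ℕ) < k - M % k then 0 else 1), ?_, ?_, ?_⟩
  · intro i j hij
    have : (i : ℕ) < j := hij
    dsimp only
    split_ifs <;> omega
  · intro i
    have := i.2
    generalize M / k = q at *
    dsimp only
    split_ifs <;> omega
  · have hr : M % k < k := Nat.mod_lt _ hk
    have : ∑ i : Fin k, (if (i : ℕ) < k - M % k then 0 else 1) = M % k := by
      rw [Fin.sum_univ_eq_sum_range fun i ↦ if i < k - M % k then 0 else 1,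
        ← Finset.sum_range_add_sum_Ico _ (Nat.sub_le k (M % k)),
        Finset.sum_eq_zero fun i hi ↦ if_pos (Finset.mem_range.1 hi),
        Finset.sum_congr rfl fun i hi ↦ if_neg (not_lt.2 (Finset.mem_Ico.1 hi).1)]
      simp
      omega
    rw [Finset.sum_add_distrib, Finset.sum_add_distrib, this]
    simp only [Finset.sum_const, Finset.card_univ, Fintype.card_fin, smul_eq_mul]
    rw [Nat.div_add_mod, add_comm]

/-- In `a ^ M - b ^ M = (a - b) * ∑ …` the factor `a - b` is the constant `-t`, so only degree `M -
1` remains. -/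
theorem totalDegree_sum_X_sub_C_pow_sub_lt {R σ : Type*} [CommRing R] [Fintype σ] (t : R) {M : ℕ}
    (hM : 0 < M) :
    ((∑ i : σ, X i - C t) ^ M - 1 - (∑ i : σ, X i) ^ M : MvPolynomial σ R).totalDegree < M := by
  have h1 : (∑ i : σ, X i : MvPolynomial σ R).totalDegree ≤ 1 :=
    totalDegree_finsetSum_le fun i _ ↦ by
      rcases subsingleton_or_nontrivial R with _ | _
      · simp [Subsingleton.elim (X i : MvPolynomial σ R) 0]
      · simp
  have h2 : (∑ i : σ, X i - C t : MvPolynomial σ R).totalDegree ≤ 1 :=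
    (totalDegree_sub_C_le _ _).trans h1
  rw [sub_right_comm, ← (Commute.all _ _).mul_geom_sum₂, ← C_1]
  refine (totalDegree_sub_C_le _ _).trans_lt ?_
  rw [sub_sub_cancel_left, neg_mul, totalDegree_neg, ← smul_eq_C_mul]
  refine (totalDegree_smul_le _ _).trans_lt ?_
  refine (totalDegree_finsetSum_le (d := M - 1) fun i hi ↦ ?_).trans_lt (by omega)
  refine (totalDegree_mul _ _).trans ?_
  have h3 := (totalDegree_pow (∑ i : σ, X i - C t : MvPolynomial σ R) i).trans
    (Nat.mul_le_mul_left i h2)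
  have h4 := (totalDegree_pow (∑ i : σ, X i : MvPolynomial σ R) (M - 1 - i)).trans
    (Nat.mul_le_mul_left _ h1)
  have := Finset.mem_range.1 hi
  omega

/-- A weak form of the Dias da Silva–Hamidoune theorem: if `p - 1 < k (|A| - k)`, then every residue
modulo `p` is a sum of `k` distinct elements of `A`. -/
theorem exists_subset_card_eq_sum_eq {p : ℕ} [Fact p.Prime] (A : Finset (ZMod p)) {k : ℕ}
    (hk : p - 1 < k * (#A - k)) (t : ZMod p) : ∃ S ⊆ A, #S = k ∧ ∑ x ∈ S, x = t := by
  have hp : p.Prime := Fact.out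
  obtain ⟨c, hmono, hlt, hsum⟩ := exists_strictMono_sum_eq hk
  have hAp : #A ≤ p := (Finset.card_le_univ A).trans_eq (ZMod.card p)
  -- `((E - t) ^ (p - 1) - 1) * V` is nonzero only at points with distinct coordinates (`V ≠ 0`) and
  -- sum `t` (Fermat). The Nullstellensatz finds such a point in `A ^ k` once the top coefficient at
  -- `c` is nonzero.
  set V := (Matrix.vandermonde (X : Fin k → MvPolynomial (Fin k) (ZMod p))).det with hV
  set E : MvPolynomial (Fin k) (ZMod p) := ∑ i, X i
  set e := Finsupp.equivFunOnFinite.symm c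
  have he : e.degree = p - 1 + ∑ i : Fin k, (i : ℕ) := by
    rw [Finsupp.degree_eq_sum, ← hsum]; rfl
  have hVdeg : V.totalDegree ≤ _ := totalDegree_det_vandermonde_X_le k
  have hp1 : 0 < p - 1 := by have := hp.two_le; omega
  have hlow : coeff e (((E - C t) ^ (p - 1) - 1 - E ^ (p - 1)) * V) = 0 := by
    apply coeff_eq_zero_of_totalDegree_lt
    refine (totalDegree_mul _ _).trans_lt ?_
    change _ < e.degree
    rw [he]
    exact add_lt_add_of_lt_of_le (totalDegree_sum_X_sub_C_pow_sub_lt t hp1) hVdeg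
  have htop : coeff e (E ^ (p - 1) * V) ≠ 0 := by
    intro h0
    have h := prod_factorial_mul_coeff_sum_X_pow_mul_vandermonde (R := ZMod p) c hsum
    rw [h0, mul_zero, eq_comm, mul_eq_zero] at h
    rcases h with h | h
    -- `(p - 1)!` is a unit modulo `p`, and the `c i` are distinct and below `p`.
    · rw [ZMod.natCast_eq_zero_iff, hp.dvd_factorial] at h
      omega
    · refine Matrix.det_vandermonde_ne_zero_iff.2 (fun i j hij ↦ hmono.injective ?_) h
      rw [ZMod.natCast_eq_natCast_iff'] at hij
      rwa [Nat.mod_eq_of_lt ((hlt i).trans_le hAp), Nat.mod_eq_of_lt ((hlt j).trans_le hAp)] at hij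
  have hcoeff : coeff e (((E - C t) ^ (p - 1) - 1) * V) ≠ 0 := by
    rwa [← sub_add_cancel ((E - C t) ^ (p - 1) - 1) (E ^ (p - 1)), add_mul, coeff_add, hlow,
      zero_add]
  have hdeg : (((E - C t) ^ (p - 1) - 1) * V).totalDegree = e.degree := by
    refine le_antisymm ?_ (le_totalDegree (mem_support_iff.2 hcoeff))
    refine (totalDegree_mul _ _).trans ?_
    rw [he]
    refine add_le_add ?_ hVdeg
    rw [← C_1]
    refine (totalDegree_sub_C_le _ _).trans ((totalDegree_pow _ _).trans ?_)
    refine (Nat.mul_le_mul_left _ ((totalDegree_sub_C_le _ _).trans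
      (totalDegree_finsetSum_le (d := 1) fun i _ ↦ ?_))).trans_eq (mul_one _)
    simp
  obtain ⟨s, hsA, hs⟩ := combinatorial_nullstellensatz_exists_eval_nonzero _ e hcoeff hdeg
    (fun _ ↦ A) hlt
  rw [map_mul] at hs
  have hinj : Function.Injective s := by
    rw [← Matrix.det_vandermonde_ne_zero_iff]
    convert right_ne_zero_of_mul hs
    rw [hV, RingHom.map_det]
    congr 1
    ext i j
    simp [Matrix.vandermonde_apply]
  refine ⟨univ.map ⟨s, hinj⟩, ?_, by simp, ?_⟩
  · intro x hx
    obtain ⟨i, -, rfl⟩ := Finset.mem_map.1 hx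
    exact hsA i
  · have h := left_ne_zero_of_mul hs
    by_contra hne
    apply h
    rw [Finset.sum_map] at hne
    have : ∑ i, s i - t ≠ 0 := sub_ne_zero.2 hne
    simp [E, ZMod.pow_card_sub_one_eq_one this]

end RestrictedSums

/-! ### Rigidity of strictly monotone maps between Boolean lattices. -/

section BooleanLatticeMaps

open Finset

/-- If `h i = g j ≠ h j`, every third index takes the value `g i` or `g j`. With at least two such
indices, injectivity of `g` makes them agree, and their common value is `v`. -/
theorem exists_eq_of_pairwise_eq_or_eq {α β : Type*} {J : Finset α}
    (hJ : 4 ≤ #J) {g h : α → β} (hg : Function.Injective g)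
    (hpair : ∀ i ∈ J, ∀ j ∈ J, i ≠ j → h i = h j ∨ h i = g j ∨ h j = g i) :
    ∃ v, ∀ j ∈ J, g j ≠ v → h j = v := by
  classical
  by_cases hconst : ∀ i ∈ J, ∀ j ∈ J, h i = h j
  · obtain ⟨i, hi⟩ : J.Nonempty := card_pos.1 (by omega)
    exact ⟨h i, fun j hj _ ↦ hconst j hj i hi⟩
  have key : ∃ i ∈ J, ∃ j ∈ J, i ≠ j ∧ h i ≠ h j ∧ h i = g j := by
    push Not at hconst
    obtain ⟨i, hi, j, hj, hij⟩ := hconst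
    have hij' : i ≠ j := fun e ↦ hij (e ▸ rfl)
    rcases hpair i hi j hj hij' with e | e | e
    · exact absurd e hij
    · exact ⟨i, hi, j, hj, hij', hij, e⟩
    · exact ⟨j, hj, i, hi, hij'.symm, hij.symm, e⟩
  obtain ⟨i, hi, j, hj, hij, hhij, hhi⟩ := key
  have hother : ∀ x ∈ J, x ≠ i → x ≠ j → h x = g i ∨ h x = g j := by
    intro x hx hxi hxj
    rcases hpair i hi x hx hxi.symm with e | e | e
    · exact Or.inr (e ▸ hhi)
    · exact absurd (hg (hhi.symm.trans e)) hxj.symm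
    · exact Or.inl e
  have hsame : ∀ x ∈ J, x ≠ i → x ≠ j → ∀ y ∈ J, y ≠ i → y ≠ j → h x = h y := by
    intro x hx hxi hxj y hy hyi hyj
    by_cases hxy : x = y
    · rw [hxy]
    rcases hpair x hx y hy hxy with e | e | e
    · exact e
    · rcases hother x hx hxi hxj with e' | e'
      · exact absurd (hg (e.symm.trans e')) hyi
      · exact absurd (hg (e.symm.trans e')) hyj
    · rcases hother y hy hyi hyj with e' | e'
      · exact absurd (hg (e.symm.trans e')) hxi
      · exact absurd (hg (e.symm.trans e')) hxj
  have hcard : 1 < #((J.erase i).erase j) := by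
    rw [card_erase_of_mem (mem_erase.2 ⟨hij.symm, hj⟩), card_erase_of_mem hi]
    omega
  obtain ⟨x, hx, y, hy, hxy⟩ := one_lt_card.1 hcard
  simp only [mem_erase] at hx hy
  obtain ⟨hxj, hxi, hx⟩ := hx
  obtain ⟨hyj, hyi, hy⟩ := hy
  have hyx := hsame y hy hyi hyj x hx hxi hxj
  rcases hother x hx hxi hxj with e | e
  · refine ⟨g i, fun z hz hzi ↦ ?_⟩
    by_cases hzj : z = j
    · subst hzj
      rcases hpair z hz x hx hxj.symm with e1 | e1 | e1
      · exact e1.trans e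
      · rcases hpair z hz y hy hyj.symm with e2 | e2 | e2
        · exact e2.trans (hyx.trans e)
        · exact absurd (hg (e1.symm.trans e2)) hxy
        · exact absurd (hg (e2.symm.trans (hyx.trans e))) hij.symm
      · exact absurd (hg (e1.symm.trans e)) hij.symm
    · have hzi' : z ≠ i := fun e ↦ hzi (e ▸ rfl)
      exact (hsame z hz hzi' hzj x hx hxi hxj).trans e
  · refine ⟨g j, fun z hz hzj ↦ ?_⟩
    have hzj' : z ≠ j := fun e ↦ hzj (e ▸ rfl)
    by_cases hzi : z = i
    · exact hzi ▸ hhi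
    · exact (hsame z hz hzi hzj' x hx hxi hxj).trans e

/-- Induction on `r`: on the supersets of `W` with one more element, `a` has a generic value `b W`,
and `b` inherits the hypothesis one level down. The bound on `r` leaves four elements outside `W`.
-/
theorem exists_eq_of_star_eq_or_eq {α β : Type*} [Fintype α] [DecidableEq α] {g : α → β}
    (hg : Function.Injective g) (r : ℕ) (hr : r + 3 ≤ Fintype.card α) (a : Finset α → β)
    (hpair : ∀ W, #W + 1 = r → ∀ i ∉ W, ∀ j ∉ W, i ≠ j →
      a (insert i W) = a (insert j W) ∨ a (insert i W) = g j ∨ a (insert j W) = g i) :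
    ∃ v, ∀ S, #S = r → (∀ i ∈ S, g i ≠ v) → a S = v := by
  induction r generalizing a with
  | zero => exact ⟨a ∅, fun S hS _ ↦ by rw [card_eq_zero.1 hS]⟩
  | succ r ih =>
    have hstar : ∀ W : Finset α, ∃ v, #W = r → ∀ j ∉ W, g j ≠ v → a (insert j W) = v := by
      intro W
      by_cases hW : #W = r
      · obtain ⟨v, hv⟩ := exists_eq_of_pairwise_eq_or_eq (J := Wᶜ) (g := g)
          (h := fun j ↦ a (insert j W)) (by rw [card_compl]; omega) hg
          (fun i hi j hj hij ↦ hpair W (by rw [hW]) i (mem_compl.1 hi) j (mem_compl.1 hj) hij)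
        exact ⟨v, fun _ j hj ↦ hv j (mem_compl.2 hj)⟩
      · exact ⟨a W, fun h ↦ absurd h hW⟩
    choose b hb using hstar
    obtain ⟨v, hv⟩ := ih (by omega) b
      (by
        intro V hV i hi j hj hij
        by_cases h1 : b (insert i V) = g j
        · exact Or.inr (Or.inl h1)
        by_cases h2 : b (insert j V) = g i
        · exact Or.inr (Or.inr h2)
        left
        -- Outside the exceptional cases both values equal `a (insert i (insert j V))`.
        rw [← hb (insert i V) (by rw [card_insert_of_notMem hi, hV]) j
            (by simp [hij.symm, hj]) (Ne.symm h1),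
          ← hb (insert j V) (by rw [card_insert_of_notMem hj, hV]) i
            (by simp [hij, hi]) (Ne.symm h2), insert_comm])
    refine ⟨v, fun S hS hSv ↦ ?_⟩
    obtain ⟨j, hj⟩ : S.Nonempty := card_pos.1 (by omega)
    have hW : #(S.erase j) = r := by rw [card_erase_of_mem hj, hS]; rfl
    have hbv := hv _ hW fun i hi ↦ hSv i (mem_of_mem_erase hi)
    have := hb _ hW j (notMem_erase j S) (by rw [hbv]; exact hSv j hj)
    rwa [insert_erase hj, hbv] at this

theorem card_add_card_le_of_strictMono {α β : Type*} {f : Finset α → Finset β}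
    (hf : StrictMono f) {S T : Finset α} (h : S ⊆ T) : #(f S) + #T ≤ #(f T) + #S := by
  classical
  induction T using Finset.strongInduction with
  | H T ih =>
    rcases h.eq_or_ssubset with rfl | hST
    · rfl
    · obtain ⟨x, hxT, hxS⟩ := exists_of_ssubset hST
      have h1 := ih (T.erase x) (erase_ssubset hxT) (subset_erase.2 ⟨h, hxS⟩)
      have h2 := card_lt_card (hf (erase_ssubset hxT))
      have h3 := card_erase_add_one hxT
      omega

/-- A strictly monotone map between Boolean lattices that preserves the rank of atoms and raises
the ranks `k` and `k + 1` by one is, on the layer `k`, an injection of the ground sets followed by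
adding a fixed element `v`, as long as `v` is not yet present. -/
theorem exists_eq_insert_map {α β : Type*} [Fintype α] [DecidableEq β]
    {f : Finset α → Finset β} (hf : StrictMono f) (hinj : Function.Injective f) {k : ℕ}
    (hk : k + 3 ≤ Fintype.card α) (hone : ∀ S, #S = 1 → #(f S) = 1)
    (hcard : ∀ S, #S = k → #(f S) = k + 1) (hcard' : ∀ S, #S = k + 1 → #(f S) = k + 2) :
    ∃ (g : α ↪ β) (v : β), ∀ S, #S = k → v ∉ S.map g → f S = insert v (S.map g) := by
  classical
  have hatom : ∀ i, ∃ x, f {i} = {x} := fun i ↦ card_eq_one.1 (hone _ (card_singleton i))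
  choose g hg using hatom
  have hginj : Function.Injective g := fun i j h ↦
    singleton_injective (hinj (by rw [hg, hg, h]))
  have hsub : ∀ S, S.map ⟨g, hginj⟩ ⊆ f S := by
    intro S x hx
    obtain ⟨i, hi, rfl⟩ := mem_map.1 hx
    exact hf.monotone (singleton_subset_iff.2 hi) (by rw [hg]; exact mem_singleton_self _)
  have hex : ∀ S, ∃ x, #S = k → f S \ S.map ⟨g, hginj⟩ = {x} := by
    intro S
    by_cases hS : #S = k
    · have : #(f S \ S.map ⟨g, hginj⟩) = 1 := by
        rw [card_sdiff_of_subset (hsub S), hcard S hS, card_map, hS]; omega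
      obtain ⟨x, hx⟩ := card_eq_one.1 this
      exact ⟨x, fun _ ↦ hx⟩
    · obtain ⟨i⟩ : Nonempty α := Fintype.card_pos_iff.1 (by omega)
      exact ⟨g i, fun h ↦ absurd h hS⟩
  choose a ha using hex
  have hmem : ∀ S, #S = k → a S ∈ f S ∧ a S ∉ S.map ⟨g, hginj⟩ := by
    intro S hS
    rw [← mem_sdiff, ha S hS]
    exact mem_singleton_self _
  obtain ⟨v, hv⟩ := exists_eq_of_star_eq_or_eq hginj k hk a
    (by
      intro W hW i hi j hj hij
      by_cases h1 : a (insert i W) = g j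
      · exact Or.inr (Or.inl h1)
      by_cases h2 : a (insert j W) = g i
      · exact Or.inr (Or.inr h2)
      left
      -- `f T` has only one element outside the image of `T`; both extra elements lie in `f T`, so
      -- outside the exceptional cases both are that one.
      set T := insert i (insert j W) with hT
      have hTc : #T = k + 1 := by
        rw [hT, card_insert_of_notMem (by simp [hij, hi]), card_insert_of_notMem hj, hW]
      have hone : #(f T \ T.map ⟨g, hginj⟩) = 1 := by
        rw [card_sdiff_of_subset (hsub T), hcard' T hTc, card_map, hTc]; omega
      obtain ⟨x, hx⟩ := card_eq_one.1 hone
      have hi' := hmem (insert i W) (by rw [card_insert_of_notMem hi, hW])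
      have hj' := hmem (insert j W) (by rw [card_insert_of_notMem hj, hW])
      have hmi : a (insert i W) ∈ f T \ T.map ⟨g, hginj⟩ := by
        refine mem_sdiff.2 ⟨hf.monotone ?_ hi'.1, ?_⟩
        · exact insert_subset_insert i (subset_insert j W)
        · have := hi'.2
          rw [hT, insert_comm i j, map_insert, mem_insert]
          exact fun h ↦ h.elim h1 this
      have hmj : a (insert j W) ∈ f T \ T.map ⟨g, hginj⟩ := by
        refine mem_sdiff.2 ⟨hf.monotone (subset_insert i _) hj'.1, ?_⟩
        have := hj'.2
        rw [hT, map_insert, mem_insert]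
        exact fun h ↦ h.elim h2 this
      rw [hx, mem_singleton] at hmi hmj
      rw [hmi, hmj])
  refine ⟨⟨g, hginj⟩, v, fun S hS hvS ↦ ?_⟩
  have : a S = v := hv S hS fun i hi h ↦ hvS (h ▸ mem_map_of_mem ⟨g, hginj⟩ hi)
  rw [← sdiff_union_of_subset (hsub S), ha S hS, this]
  rfl

end BooleanLatticeMaps

/-! ### The two colour classes and the choice of parameters. -/

section TwoColouring

open Finset

theorem injective_natCast_succ {N p : ℕ} [Fact p.Prime] (hN : N ≤ p) :
    Function.Injective fun i : Fin N ↦ (((i : ℕ) + 1 : ℕ) : ZMod p) := by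
  intro i j hij
  have h : (i : ℕ) ≡ j [MOD p] :=
    Nat.ModEq.add_right_cancel' 1 ((ZMod.natCast_eq_natCast_iff _ _ _).1 hij)
  exact Fin.ext (h.eq_of_lt_of_lt (i.2.trans_le hN) (j.2.trans_le hN))

theorem exists_subset_card_eq_sum_succ_eq {N p k : ℕ} [Fact p.Prime] (hN : N ≤ p)
    (X : Finset (Fin N)) (hk : p - 1 < k * (#X - k)) (t : ZMod p) :
    ∃ S ⊆ X, #S = k ∧ ((∑ i ∈ S, ((i : ℕ) + 1) : ℕ) : ZMod p) = t := by
  classical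
  have hinj := injective_natCast_succ hN
  obtain ⟨S', hS', hcard, hsum⟩ := exists_subset_card_eq_sum_eq
    (X.map ⟨_, hinj⟩) (by rwa [card_map]) t
  obtain ⟨S, hS, rfl⟩ := subset_map_iff.1 hS'
  refine ⟨S, hS, by rwa [card_map] at hcard, ?_⟩
  rw [sum_map] at hsum
  rw [← hsum, Nat.cast_sum]
  rfl

/-- Distinct codewords of the sum code have distance at least four. -/
theorem four_le_card_symmDiff_of_mem_sumCode {N w p d : ℕ} (hp : p.Prime) (hN : N ≤ p)
    {S T : Finset (Fin N)} (hS : S ∈ sumCode N w p d) (hT : T ∈ sumCode N w p d) (hne : S ≠ T) :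
    4 ≤ #(symmDiff S T) := by
  have : Fact p.Prime := ⟨hp⟩
  have h1 := card_sdiff_add_card_inter S T
  have h2 := card_sdiff_add_card_inter T S
  rw [inter_comm T S, hT.1] at h2
  rw [hS.1] at h1
  have hsd : #(symmDiff S T) = #(S \ T) + #(T \ S) := by
    rw [symmDiff_def, sup_eq_union, card_union_of_disjoint disjoint_sdiff_sdiff]
  by_contra hlt
  have hST0 : #(S \ T) ≠ 0 := by
    intro h0
    rw [card_eq_zero, sdiff_eq_empty_iff_subset] at h0
    exact hne (eq_of_subset_of_card_le h0 (by rw [hS.1, hT.1]))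
  obtain ⟨x, hx⟩ := card_eq_one.1 (show #(S \ T) = 1 by omega)
  obtain ⟨y, hy⟩ := card_eq_one.1 (show #(T \ S) = 1 by omega)
  have hxy : (x : ℕ) + 1 ≡ y + 1 [MOD p] := by
    have h := hS.2.trans hT.2.symm
    rw [← sum_inter_add_sum_sdiff S T, ← sum_inter_add_sum_sdiff T S, inter_comm T S, hx, hy,
      sum_singleton, sum_singleton] at h
    exact Nat.ModEq.add_left_cancel' _ h
  have hxy' : x = y := injective_natCast_succ hN ((ZMod.natCast_eq_natCast_iff _ _ _).2 hxy)
  have hxS : x ∈ S \ T := hx ▸ mem_singleton_self x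
  have hyT : y ∈ T \ S := hy ▸ mem_singleton_self y
  exact (mem_sdiff.1 hyT).2 (hxy' ▸ (mem_sdiff.1 hxS).1)

/-- The union of the layer `k`, the code of weight `k + 1`, and the layers `k + 3, …, k + m + 1`. -/
def blueFamily (N m k p d : ℕ) : Set (BooleanLattice N) :=
  layer N k ∪ sumCode N (k + 1) p d ∪ ⋃ j ∈ Set.Icc (k + 3) (k + m + 1), layer N j

theorem mem_blueFamily {N m k p d : ℕ} {S : BooleanLattice N} :
    S ∈ blueFamily N m k p d ↔
      #S = k ∨ S ∈ sumCode N (k + 1) p d ∨ (k + 3 ≤ #S ∧ #S ≤ k + m + 1) := by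
  simp [blueFamily, layer, or_assoc]

theorem not_isWeakSubposet_blueFamily {N m k p d : ℕ} (hm : 2 ≤ m) (hp : p.Prime) (hN : N ≤ p) :
    ¬ IsWeakSubposet (BooleanLattice m) (blueFamily N m k p d) := by
  rintro ⟨F, hinj, hmono⟩
  set f : BooleanLattice m → BooleanLattice N := fun S ↦ F S
  have hfinj : Function.Injective f := Subtype.val_injective.comp hinj
  have hfs : StrictMono f := Monotone.strictMono_of_injective (fun _ _ h ↦ hmono h) hfinj
  have hB : ∀ S, #(f S) = k ∨ f S ∈ sumCode N (k + 1) p d ∨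
      (k + 3 ≤ #(f S) ∧ #(f S) ≤ k + m + 1) := fun S ↦ mem_blueFamily.1 (F S).2
  have hlow : k ≤ #(f ∅) := by
    rcases hB ∅ with h | h | h
    · omega
    · have := h.1; omega
    · omega
  have hhigh : #(f univ) ≤ k + m + 1 := by
    rcases hB univ with h | h | h
    · omega
    · have := h.1; omega
    · omega
  -- Room for `m - 1` more ranks above limits an atom to size `k + 1` or `k + 2`, and no blue set
  -- has size `k + 2`.
  have hatom : ∀ i, f {i} ∈ sumCode N (k + 1) p d := by
    intro i
    have h1 := card_add_card_le_of_strictMono hfs (empty_subset {i})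
    have h2 := card_add_card_le_of_strictMono hfs (subset_univ {i})
    rw [card_univ, Fintype.card_fin] at h2
    simp only [card_singleton, card_empty] at h1 h2
    rcases hB {i} with h | h | h
    · omega
    · exact h
    · omega
  let i : Fin m := ⟨0, by omega⟩
  let j : Fin m := ⟨1, by omega⟩
  have hij : f {i} ≠ f {j} := fun h ↦ by
    have := singleton_injective (hfinj h)
    simp [i, j] at this
  have h4 := four_le_card_symmDiff_of_mem_sumCode hp hN (hatom i) (hatom j) hij
  have hsub : f ∅ ⊆ f {i} ∩ f {j} :=
    subset_inter (hfs.monotone (empty_subset _)) (hfs.monotone (empty_subset _))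
  have h1 := card_sdiff_add_card_inter (f {i}) (f {j})
  have h2 := card_sdiff_add_card_inter (f {j}) (f {i})
  rw [inter_comm, (hatom j).1] at h2
  rw [(hatom i).1] at h1
  have h3 := card_le_card hsub
  rw [symmDiff_def, sup_eq_union, card_union_of_disjoint disjoint_sdiff_sdiff] at h4
  omega

theorem not_isWeakSubposet_compl_blueFamily {m n k p d : ℕ} (hp : p.Prime) (hN : n + m ≤ p)
    (hk : 2 ≤ k) (hkn : k + 3 ≤ n) (hsum : p - 1 < k * (n - 1 - k)) :
    ¬ IsWeakSubposet (BooleanLattice n) ((blueFamily (n + m) m k p d)ᶜ : Set _) := by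
  have : Fact p.Prime := ⟨hp⟩
  rintro ⟨F, hinj, hmono⟩
  set f : BooleanLattice n → BooleanLattice (n + m) := fun S ↦ F S
  have hfinj : Function.Injective f := Subtype.val_injective.comp hinj
  have hfs : StrictMono f := Monotone.strictMono_of_injective (fun _ _ h ↦ hmono h) hfinj
  have hR : ∀ S, ¬ (#(f S) = k ∨ f S ∈ sumCode (n + m) (k + 1) p d ∨
      (k + 3 ≤ #(f S) ∧ #(f S) ≤ k + m + 1)) := fun S h ↦ (F S).2 (mem_blueFamily.2 h)
  have hlow : ∀ S, #S ≤ #(f S) := fun S ↦ by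
    have := card_add_card_le_of_strictMono hfs (empty_subset S)
    rw [card_empty] at this
    omega
  have hhigh : ∀ S, #(f S) ≤ #S + m := fun S ↦ by
    have := card_add_card_le_of_strictMono hfs (subset_univ S)
    have h2 := card_le_univ (f univ)
    rw [card_univ, Fintype.card_fin] at this
    rw [Fintype.card_fin] at h2
    omega
  have hup : ∀ S : Finset (Fin n), ∀ r, #S ≤ r → r ≤ n →
      ∃ T, #T = r ∧ #(f S) + r ≤ #(f T) + #S := by
    intro S r hS hr
    obtain ⟨T, hST, hT⟩ := exists_superset_card_eq hS (by rwa [Fintype.card_fin])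
    exact ⟨T, hT, hT ▸ card_add_card_le_of_strictMono hfs hST⟩
  have hsucc : ∀ S, #S = k + 1 → #(f S) ≤ k + 2 := fun S hS ↦ by
    have := hhigh S
    have := hR S
    omega
  have hcard : ∀ S, #S = k → #(f S) = k + 1 := fun S hS ↦ by
    obtain ⟨T, hT, hST⟩ := hup S (k + 1) (by omega) (by omega)
    have := hsucc T hT
    have := hlow S
    have := hR S
    omega
  have hcard' : ∀ S, #S = k + 1 → #(f S) = k + 2 := fun S hS ↦ by
    obtain ⟨T, hTS, hT⟩ := exists_subset_card_eq (show k ≤ #S by omega)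
    have := card_add_card_le_of_strictMono hfs hTS
    have := hcard T hT
    have := hsucc S hS
    omega
  -- Rank `k - 1` maps to size `k - 1` or `k`; layer `k` is blue, so no rank is gained up to there.
  have hone : ∀ S, #S = 1 → #(f S) = 1 := fun S hS ↦ by
    obtain ⟨T, hT, hST⟩ := hup S (k - 1) (by omega) (by omega)
    obtain ⟨U, hU, hTU⟩ := hup T k (by omega) (by omega)
    have := hcard U hU
    have := hR T
    have := hlow S
    omega
  obtain ⟨g, v, hgv⟩ := exists_eq_insert_map hfs hfinj (by rwa [Fintype.card_fin]) hone hcard hcard'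
  -- The target residue is `d` minus the label of `v`, so that adding `v` completes a codeword.
  -- Erasing `v` costs at most one point, whence `n - 1`.
  obtain ⟨S', hS', hS'c, hS's⟩ := exists_subset_card_eq_sum_succ_eq (k := k) hN
    ((univ.map g).erase v)
    (hsum.trans_le (Nat.mul_le_mul_left k (Nat.sub_le_sub_right
      (by have := pred_card_le_card_erase (s := univ.map g) (a := v)
          simpa using this) k))) ((d : ZMod p) - ((v : ℕ) + 1 : ℕ))
  obtain ⟨S, -, rfl⟩ := subset_map_iff.1 (hS'.trans (erase_subset _ _))
  have hv : v ∉ S.map g := fun h ↦ notMem_erase v _ (hS' h)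
  rw [card_map] at hS'c
  have hfS := hgv S hS'c hv
  refine hR S (Or.inr (Or.inl ⟨hcard S hS'c, ?_⟩))
  rw [← ZMod.natCast_eq_natCast_iff, hfS, sum_insert hv, Nat.cast_add, hS's]
  ring

/-- With `s` the lower bound, the ceiling of `s` works if `s ≤ (n - 2) / 2`; squared, this reads `(n
- 18) ^ 2 ≥ 32 * m + 260`, the source of the constants. -/
theorem exists_middle_layer {m n : ℕ} (hn : Real.sqrt (32 * (m : ℝ) + 260) + 18 ≤ (n : ℝ)) :
    ∃ k : ℕ, Real.sqrt (8 * ((n : ℝ) + m) - 15) ≤ (k : ℝ) ∧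
      (k : ℝ) ≤ (n : ℝ) - 1 - Real.sqrt (8 * ((n : ℝ) + m) - 15) := by
  refine ⟨_, Nat.le_ceil _, ?_⟩
  have hlt := Nat.ceil_lt_add_one (Real.sqrt_nonneg (8 * ((n : ℝ) + m) - 15))
  have h1 := Real.sq_sqrt (show (0 : ℝ) ≤ 32 * m + 260 by positivity)
  have h0 := Real.sqrt_nonneg (32 * (m : ℝ) + 260)
  have h2 : Real.sqrt (8 * ((n : ℝ) + m) - 15) ≤ ((n : ℝ) - 2) / 2 := by
    apply Real.sqrt_le_iff.2
    constructor
    · linarith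
    · nlinarith
  linarith

end TwoColouring

theorem theorem4 (m n : ℕ) (hm : 2 ≤ m) (hn : Real.sqrt (32 * (m : ℝ) + 260) + 18 ≤ (n : ℝ)) :
    ∃ B R : Set (BooleanLattice (n + m)),
      Disjoint B R ∧ B ∪ R = Set.univ ∧
      ¬ IsWeakSubposet (BooleanLattice m) B ∧
      ¬ IsWeakSubposet (BooleanLattice n) R ∧
      ∃ k p d : ℕ,
        Real.sqrt (8 * ((n : ℝ) + m) - 15) ≤ (k : ℝ) ∧
        (k : ℝ) ≤ (n : ℝ) - 1 - Real.sqrt (8 * ((n : ℝ) + m) - 15) ∧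
        p.Prime ∧ n + m ≤ p ∧ p < 2 * (n + m - 1) ∧
        1 ≤ d ∧ d ≤ p ∧
        (∀ S ∈ sumCode (n + m) (k + 1) p d, ∀ T ∈ sumCode (n + m) (k + 1) p d,
          S ≠ T → 4 ≤ (symmDiff S T).card) ∧
        B = layer (n + m) k ∪ sumCode (n + m) (k + 1) p d ∪
          ⋃ j ∈ Set.Icc (k + 3) (k + m + 1), layer (n + m) j := by
  obtain ⟨k, hk1, hk2⟩ := exists_middle_layer hn
  have hn18 : 18 ≤ n := by
    have : (18 : ℝ) ≤ n := by linarith [Real.sqrt_nonneg (32 * (m : ℝ) + 260)]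
    exact_mod_cast this
  obtain ⟨p, hp, hlt, hle⟩ := Nat.exists_prime_lt_and_le_two_mul (n + m - 1) (by omega)
  have hp2 : p ≠ 2 * (n + m - 1) := by
    rintro rfl
    exact Nat.not_prime_mul (by omega) (by omega) hp
  have hN : n + m ≤ p := by omega
  have hn18' : (18 : ℝ) ≤ n := by exact_mod_cast hn18
  have hnn : (0 : ℝ) ≤ 8 * ((n : ℝ) + m) - 15 := by
    have : (0 : ℝ) ≤ m := m.cast_nonneg
    linarith
  have hsq := Real.sq_sqrt hnn
  have h3 : 3 ≤ Real.sqrt (8 * ((n : ℝ) + m) - 15) := by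
    apply Real.le_sqrt_of_sq_le
    have : (0 : ℝ) ≤ m := m.cast_nonneg
    linarith
  have hk3 : 3 ≤ k := by
    have : (3 : ℝ) ≤ k := h3.trans hk1
    exact_mod_cast this
  have hkn : k + 4 ≤ n := by
    have : (k : ℝ) + 4 ≤ n := by linarith
    exact_mod_cast this
  -- Both factors are at least the square root; the product then exceeds `p - 1` because `p < 2 * (n
  -- + m - 1)`.
  have hprod : 8 * (n + m) - 15 ≤ k * (n - 1 - k) := by
    have h : 8 * ((n : ℝ) + m) - 15 ≤ k * (n - 1 - k) := by
      rw [← hsq, sq]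
      exact mul_le_mul hk1 (by linarith) (by linarith) (by linarith)
    have hcast : ((n - 1 - k : ℕ) : ℝ) = n - 1 - k := by
      rw [Nat.cast_sub (by omega), Nat.cast_sub (by omega), Nat.cast_one]
    rw [← hcast] at h
    rw [Nat.sub_le_iff_le_add]
    have h' : 8 * ((n : ℝ) + m) ≤ k * ((n - 1 - k : ℕ) : ℝ) + 15 := by linarith
    exact_mod_cast h'
  -- The residue `d = 1` is arbitrary: both halves hold for every `d`.
  exact ⟨blueFamily (n + m) m k p 1, (blueFamily (n + m) m k p 1)ᶜ, disjoint_compl_right,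
    Set.union_compl_self _, not_isWeakSubposet_blueFamily hm hp hN,
    not_isWeakSubposet_compl_blueFamily hp hN (by omega) (by omega) (by omega),
    k, p, 1, hk1, hk2, hp, hN, by omega, le_rfl, hp.one_le,
    fun S hS T hT hne ↦ four_le_card_symmDiff_of_mem_sumCode hp hN hS hT hne, rfl⟩
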